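/- Let $\mathrm{Nil}$ be the Heisenberg group of real matrices $\begin{pmatrix}1&x&z\\0&1&y\\0&0&1\end{pmatrix}$ with the left-invariant metric $dx^2+dy^2+(dz-x\,dy)^2$, its Levi-Civita connection $\nabla$, and the positively oriented left-invariant orthonormal frame $e_1=\partial_x$, $e_2=\partial_y+x\,\partial_z$, $e_3=\partial_z$. Let $M$ be a connected Riemann surface and $f:M\to\mathrm{Nil}$ a smooth conformal immersion. For a local complex parameter $\zeta=s+it$ on $M$, let $f^{-1}\partial_\zeta f=Z_1e_1+Z_2e_2+Z_3e_3$, where $\partial_\zeta=\tfrac12(\partial_s-i\partial_t)$, let $N$ be the unit normal such that $(f_s,f_t,N)$ is positively oriented, let $H$ be the mean curvature with respect to $N$ (half of the trace of the second fundamental form $\langle\nabla_{f_u}f_v,N\rangle$, $u,v\in\{s,t\}$), and let $A=\langle\nabla_{f_\zeta}f_\zeta,N\rangle$ be the coefficient of the Hopf differential, where the metric and the connection are extended complex-bilinearly. If the quadratic differential $$\widetilde A\,d\zeta^2=\Big(A+\frac{Z_3^2}{2H+i}\Big)d\zeta^2$$ is holomorphic, that is, if its coefficient $\widetilde A$ in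 every local complex parameter is a holomorphic function, then $H$ is constant on $M$. -/

import Mathlib

open scoped Manifold ContDiff Matrix

namespace NilGeometry

noncomputable section

/-- The Heisenberg group `Nil`: `⟨x, y, z⟩` stands for the upper triangular matrix
`!![1, x, z; 0, 1, y; 0, 0, 1]`. -/
@[ext] structure Nil where
  x : ℝ
  y : ℝ
  z : ℝ

namespace Nil

/-- The matrix that an element of `Nil` stands for. -/
def toMatrix (g : Nil) : Matrix (Fin 3) (Fin 3) ℝ :=
  !![1, g.x, g.z; 0, 1, g.y; 0, 0, 1]

/-- The global coordinates `(x, y, z)`, which give `Nil` its smooth structure. -/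
def coords (g : Nil) : Fin 3 → ℝ := ![g.x, g.y, g.z]

instance : One Nil := ⟨⟨0, 0, 0⟩⟩
instance : Mul Nil := ⟨fun g h => ⟨g.x + h.x, g.y + h.y, g.z + h.z + g.x * h.y⟩⟩
instance : Inv Nil := ⟨fun g => ⟨-g.x, -g.y, -g.z + g.x * g.y⟩⟩

@[simp] theorem one_x : (1 : Nil).x = 0 := rfl
@[simp] theorem one_y : (1 : Nil).y = 0 := rfl
@[simp] theorem one_z : (1 : Nil).z = 0 := rfl
@[simp] theorem mul_x (g h : Nil) : (g * h).x = g.x + h.x := rfl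
@[simp] theorem mul_y (g h : Nil) : (g * h).y = g.y + h.y := rfl
@[simp] theorem mul_z (g h : Nil) : (g * h).z = g.z + h.z + g.x * h.y := rfl
@[simp] theorem inv_x (g : Nil) : (g⁻¹).x = -g.x := rfl
@[simp] theorem inv_y (g : Nil) : (g⁻¹).y = -g.y := rfl
@[simp] theorem inv_z (g : Nil) : (g⁻¹).z = -g.z + g.x * g.y := rfl

instance : Group Nil where
  mul_assoc a b c := by ext <;> simp <;> ring
  one_mul a := by ext <;> simp
  mul_one a := by ext <;> simp
  inv_mul_cancel a := by ext <;> simp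

/-- The group law of `Nil` is matrix multiplication. -/
theorem toMatrix_mul (g h : Nil) : (g * h).toMatrix = g.toMatrix * h.toMatrix := by
  ext i j
  fin_cases i <;> fin_cases j <;> simp [toMatrix, Matrix.mul_apply, Fin.sum_univ_three] <;> ring

theorem toMatrix_one : (1 : Nil).toMatrix = 1 := by
  ext i j
  fin_cases i <;> fin_cases j <;> simp [toMatrix]

end Nil

/-- The basis `e₁, e₂, e₃` (indexed by `0, 1, 2`) of the Lie algebra of `Nil`. -/
def basisVec : Fin 3 → Matrix (Fin 3) (Fin 3) ℝ :=
  ![!![0, 1, 0; 0, 0, 0; 0, 0, 0], !![0, 0, 0; 0, 0, 1; 0, 0, 0], !![0, 0, 1; 0, 0, 0; 0, 0, 0]]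

/-- The coordinates, with respect to `e₁, e₂, e₃`, of an element of the Lie algebra of `Nil`. The
inner product on the Lie algebra is the one that makes `e₁, e₂, e₃` orthonormal, so it is the dot
product of these coordinates. -/
def lieCoord (X : Matrix (Fin 3) (Fin 3) ℝ) : Fin 3 → ℝ := ![X 0 1, X 1 2, X 0 2]

/-- `α i j k = ⟨[e_i, e_j], e_k⟩`. -/
def structConst (i j k : Fin 3) : ℝ := lieCoord ⁅basisVec i, basisVec j⁆ k

/-- `nabla j k i` is the `e_i`-component of `∇_{e_j} e_k`, for the Levi-Civita connection `∇` of the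
left-invariant metric in which `e₁, e₂, e₃` is an orthonormal frame (Koszul's formula). -/
def nabla (j k i : Fin 3) : ℝ :=
  (structConst j k i + structConst i j k + structConst i k j) / 2

/-- The connection has no torsion. -/
theorem nabla_torsion_free (j k i : Fin 3) : nabla j k i - nabla k j i = structConst j k i := by
  fin_cases i <;> fin_cases j <;> fin_cases k <;>
    simp [nabla, structConst, lieCoord, basisVec, Ring.lie_def] <;> norm_num

/-- The connection is compatible with the metric. -/
theorem nabla_metric (j k i : Fin 3) : nabla j k i + nabla j i k = 0 := by
  fin_cases i <;> fin_cases j <;> fin_cases k <;>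
    simp [nabla, structConst, lieCoord, basisVec, Ring.lie_def] <;> norm_num

/-- For a map `F` from (an open subset of) the plane to `Nil`, the partial derivative of `F` at `w`
in the direction `v`, as a matrix. -/
def partialDeriv (F : ℂ → Nil) (v w : ℂ) : Matrix (Fin 3) (Fin 3) ℝ :=
  Matrix.of fun i j => fderiv ℝ (fun u => (F u).toMatrix i j) w v

/-- The left translation `F⁻¹ (∂_v F)` to the Lie algebra, in the basis `e₁, e₂, e₃`; equivalently,
the components of `∂_v F` in the left-invariant orthonormal frame. -/
def vel (F : ℂ → Nil) (v w : ℂ) : Fin 3 → ℝ :=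
  lieCoord ((F w)⁻¹.toMatrix * partialDeriv F v w)

/-- In coordinates, `vel` is given by the coframe `dx, dy, dz - x dy`; in particular the induced
left-invariant metric is `dx² + dy² + (dz - x dy)²`. -/
theorem vel_eq (F : ℂ → Nil) (v w : ℂ) :
    vel F v w = ![fderiv ℝ (fun u => (F u).x) w v, fderiv ℝ (fun u => (F u).y) w v,
      fderiv ℝ (fun u => (F u).z) w v - (F w).x * fderiv ℝ (fun u => (F u).y) w v] := by
  ext i
  fin_cases i <;>
    simp [vel, lieCoord, partialDeriv, Nil.toMatrix, Matrix.mul_apply, Fin.sum_univ_three] <;> ring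

/-- The covariant derivative `∇_{∂_v F} W` of a vector field `W` along `F`; vector fields along `F`
are written in the left-invariant frame. -/
def covDeriv (F : ℂ → Nil) (v : ℂ) (W : ℂ → Fin 3 → ℝ) (w : ℂ) : Fin 3 → ℝ := fun i =>
  fderiv ℝ (fun u => W u i) w v + ∑ j, ∑ k, vel F v w j * W w k * nabla j k i

/-- The unit normal `N` for which `(∂_x F, ∂_y F, N)` is positively oriented, where
`(e₁, e₂, e₃)` is positive. -/
def normal (F : ℂ → Nil) (w : ℂ) : Fin 3 → ℝ :=
  let n := crossProduct (vel F 1 w) (vel F Complex.I w)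
  (Real.sqrt (n ⬝ᵥ n))⁻¹ • n

/-- The first fundamental form `⟨∂_u F, ∂_v F⟩` of a parametrized surface `F`. -/
def firstForm (F : ℂ → Nil) (u v w : ℂ) : ℝ := vel F u w ⬝ᵥ vel F v w

/-- The second fundamental form `⟨∇_{∂_u F} ∂_v F, N⟩` of a parametrized surface `F`. -/
def secondForm (F : ℂ → Nil) (u v w : ℂ) : ℝ := covDeriv F u (vel F v) w ⬝ᵥ normal F w

/-- The mean curvature of a parametrized surface `F` at the parameter `w`: half of the trace of the
second fundamental form with respect to the first one. -/
def meanCurv (F : ℂ → Nil) (w : ℂ) : ℝ :=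
  (firstForm F Complex.I Complex.I w * secondForm F 1 1 w
      - 2 * firstForm F 1 Complex.I w * secondForm F 1 Complex.I w
      + firstForm F 1 1 w * secondForm F Complex.I Complex.I w)
    / (2 * (firstForm F 1 1 w * firstForm F Complex.I Complex.I w - firstForm F 1 Complex.I w ^ 2))

/-- The Wirtinger derivative `∂ = (∂_x - i ∂_y) / 2`. -/
def wirtinger (g : ℂ → ℂ) (w : ℂ) : ℂ :=
  (fderiv ℝ g w 1 - Complex.I * fderiv ℝ g w Complex.I) / 2

/-- The components `Z₁, Z₂, Z₃` (indexed by `0, 1, 2`) of `F⁻¹ ∂F`. -/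
def Z (F : ℂ → Nil) (k : Fin 3) (w : ℂ) : ℂ :=
  ((vel F 1 w k : ℂ) - Complex.I * (vel F Complex.I w k : ℂ)) / 2

/-- The coefficient `A = ⟨∇_{∂F} ∂F, N⟩` of the Hopf differential `A dz²`; the connection and the
metric are extended complex-(bi)linearly. -/
def hopfCoeff (F : ℂ → Nil) (w : ℂ) : ℂ :=
  ∑ i, (wirtinger (Z F i) w + ∑ j, ∑ k, Z F j w * Z F k w * (nabla j k i : ℂ)) *
    (normal F w i : ℂ)

/-- The coefficient `A + Z₃² / (2H + i)` of the modified Hopf differential. -/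
def modifiedHopfCoeff (F : ℂ → Nil) (w : ℂ) : ℂ :=
  hopfCoeff F w + Z F 2 w ^ 2 / (2 * (meanCurv F w : ℂ) + Complex.I)

section Surface

variable {M : Type*} [TopologicalSpace M] [ChartedSpace ℂ M]

/-- `f` in the local complex parameter `e`. Only its values on `e.target` matter. -/
def inChart (f : M → Nil) (e : OpenPartialHomeomorph M ℂ) : ℂ → Nil := fun w => f (e.symm w)

/-- `f` is a smooth conformal immersion of the Riemann surface `M` into `Nil`: in each local complex
parameter `z` the induced metric has the form `e^{2α} dz dz̄`. -/
structure IsConformalImmersion (f : M → Nil) : Prop where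
  smooth : ContMDiff 𝓘(ℝ, ℂ) 𝓘(ℝ, Fin 3 → ℝ) ∞ (fun p => (f p).coords)
  pos : ∀ e ∈ atlas ℂ M, ∀ w ∈ e.target, 0 < firstForm (inChart f e) 1 1 w
  eq : ∀ e ∈ atlas ℂ M, ∀ w ∈ e.target,
    firstForm (inChart f e) Complex.I Complex.I w = firstForm (inChart f e) 1 1 w
  orthogonal : ∀ e ∈ atlas ℂ M, ∀ w ∈ e.target, firstForm (inChart f e) 1 Complex.I w = 0

/-- The mean curvature of the surface `f` at the point `p`. -/
def meanCurvature (f : M → Nil) (p : M) : ℝ :=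
  meanCurv (inChart f (chartAt ℂ p)) (chartAt ℂ p p)

/-- The quadratic differential `(A + Z₃² / (2H + i)) dz²` is holomorphic: in each local complex
parameter its coefficient is a holomorphic function. -/
def ModifiedHopfHolomorphic (f : M → Nil) : Prop :=
  ∀ e ∈ atlas ℂ M, DifferentiableOn ℂ (modifiedHopfCoeff (inChart f e)) e.target

end Surface

end

end NilGeometry

/-! Write `l` for the conformal factor `firstForm F 1 1`, and `Z₃`, `N₃` for the `e₃`-components.
Two equations drive the proof. The Codazzi equation (`dbar_hopfCoeff`) reads `∂̄A = (l/2) ∂H - (l/2)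
N₃ Z₃`, where the last term is the curvature of `Nil`. The third component of the structure equation
(`dbar_Z`) reads `∂̄Z₃ = (l/4)(2H + i) N₃`. Hence in `∂̄(A + Z₃²/(2H + i))` the curvature term
cancels (`dbar_modifiedHopfCoeff`), and holomorphy becomes `l (2H + i)² ∂H = 4 Z₃² ∂̄H`.

Since `H` is real, `|∂H| = |∂̄H|`. Where `dH ≠ 0`, taking moduli gives `l (4H² + 1) = 4|Z₃|²`. But
`4|Z₃|² ≤ l`, because the tangential part of the unit vector `e₃` has length at most one
(`vel_two_sq_add_le`). So `H = 0` wherever `dH ≠ 0` (`meanCurv_eq_zero`). That set is open, so `H`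
vanishes near each of its points, which forces `dH = 0` there; the set is therefore empty.

Thus `H` is constant on small balls in every chart. As `H` does not depend on the chart
(`meanCurv_transition`), it is locally constant on `M`, and connectedness finishes the proof. -/

namespace NilGeometry

noncomputable section

/-! ### Calculus of `∂` and `∂̄` for real-differentiable functions. -/

/-- The operator `(∂_x + c ∂_y) / 2`. For `c = -i` it is the Wirtinger derivative `∂`, for `c = i`
it is `∂̄`. -/
def wirt (c : ℂ) (g : ℂ → ℂ) (w : ℂ) : ℂ :=
  (fderiv ℝ g w 1 + c * fderiv ℝ g w Complex.I) / 2

theorem wirtinger_eq_wirt (g : ℂ → ℂ) : wirtinger g = wirt (-Complex.I) g := by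
  funext w
  simp [wirtinger, wirt, sub_eq_add_neg]

section Wirt

variable {c d : ℂ} {g h : ℂ → ℂ} {w : ℂ}

theorem wirt_congr (e : g =ᶠ[nhds w] h) : wirt c g w = wirt c h w := by
  simp only [wirt, e.fderiv_eq]

theorem wirt_const (a : ℂ) : wirt c (fun _ => a) w = 0 := by
  simp [wirt]

theorem wirt_add (hg : DifferentiableAt ℝ g w) (hh : DifferentiableAt ℝ h w) :
    wirt c (fun u => g u + h u) w = wirt c g w + wirt c h w := by
  simp only [wirt, fderiv_fun_add hg hh, add_apply]
  ring

theorem wirt_sub (hg : DifferentiableAt ℝ g w) (hh : DifferentiableAt ℝ h w) :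
    wirt c (fun u => g u - h u) w = wirt c g w - wirt c h w := by
  simp only [wirt, fderiv_fun_sub hg hh, sub_apply]
  ring

theorem wirt_mul (hg : DifferentiableAt ℝ g w) (hh : DifferentiableAt ℝ h w) :
    wirt c (fun u => g u * h u) w = wirt c g w * h w + g w * wirt c h w := by
  simp only [wirt, fderiv_fun_mul hg hh, add_apply, smul_apply, smul_eq_mul]
  ring

theorem wirt_const_mul (a : ℂ) (hg : DifferentiableAt ℝ g w) :
    wirt c (fun u => a * g u) w = a * wirt c g w := by
  rw [wirt_mul (differentiableAt_const a) hg, wirt_const]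
  ring

theorem wirt_sum {ι : Type*} (s : Finset ι) {g : ι → ℂ → ℂ}
    (hg : ∀ i ∈ s, DifferentiableAt ℝ (g i) w) :
    wirt c (fun u => ∑ i ∈ s, g i u) w = ∑ i ∈ s, wirt c (g i) w := by
  simp only [wirt, fderiv_fun_sum hg, sum_apply, Finset.mul_sum,
    ← Finset.sum_add_distrib, Finset.sum_div]

theorem wirt_conj (hg : DifferentiableAt ℝ g w) :
    wirt c (fun u => (starRingEnd ℂ) (g u)) w
      = (starRingEnd ℂ) (wirt ((starRingEnd ℂ) c) g w) := by
  have := (Complex.conjCLE.toContinuousLinearMap.hasFDerivAt.comp w hg.hasFDerivAt).fderiv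
  have e : (Complex.conjCLE.toContinuousLinearMap ∘ g) = fun u => (starRingEnd ℂ) (g u) := by
    funext u; simp
  rw [e] at this
  simp [wirt, this, map_ofNat]

theorem wirt_ofReal {g : ℂ → ℝ} (hg : DifferentiableAt ℝ g w) :
    wirt c (fun u => (g u : ℂ)) w = ((fderiv ℝ g w 1 : ℝ) + c * (fderiv ℝ g w Complex.I : ℝ)) / 2 := by
  have := (Complex.ofRealCLM.hasFDerivAt.comp w hg.hasFDerivAt).fderiv
  have e : (Complex.ofRealCLM ∘ g) = fun u => (g u : ℂ) := by
    funext u; simp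
  rw [e] at this
  simp [wirt, this]

theorem wirt_comm (hg : ContDiffAt ℝ 2 g w) :
    wirt c (wirt d g) w = wirt d (wirt c g) w := by
  have h1 : ContDiffAt ℝ 1 (fderiv ℝ g) w := hg.fderiv_right (by norm_num)
  have hd : DifferentiableAt ℝ (fderiv ℝ g) w := h1.differentiableAt (by norm_num)
  have hv : ∀ v : ℂ, DifferentiableAt ℝ (fun u => fderiv ℝ g u v) w := fun v =>
    hd.clm_apply (differentiableAt_const v)
  have key : ∀ v v' : ℂ, fderiv ℝ (fun u => fderiv ℝ g u v) w v' = fderiv ℝ (fderiv ℝ g) w v' v := by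
    intro v v'
    rw [fderiv_clm_apply hd (differentiableAt_const v)]
    simp
  have sym : fderiv ℝ (fderiv ℝ g) w 1 Complex.I = fderiv ℝ (fderiv ℝ g) w Complex.I 1 :=
    (hg.isSymmSndFDerivAt (by simp)).eq _ _
  have expand : ∀ a b : ℂ, wirt a (wirt b g) w
      = (wirt a (fun u => fderiv ℝ g u 1) w + b * wirt a (fun u => fderiv ℝ g u Complex.I) w) / 2 := by
    intro a b
    have : wirt b g = fun u => (1 / 2 : ℂ) * (fderiv ℝ g u 1 + b * fderiv ℝ g u Complex.I) := by
      funext u; simp only [wirt]; ring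
    rw [this, wirt_const_mul, wirt_add (hv _) ((hv _).const_mul b), wirt_const_mul _ (hv _)]
    · ring
    · exact (hv _).add ((hv _).const_mul b)
  rw [expand, expand]
  simp only [wirt, key, sym]
  ring

theorem wirt_holomorphic (hg : DifferentiableAt ℂ g w) : wirt Complex.I g w = 0 := by
  have h := (hg.hasFDerivAt.restrictScalars ℝ).fderiv
  have e : fderiv ℂ g w Complex.I = Complex.I * fderiv ℂ g w 1 := by
    rw [← smul_eq_mul, ← map_smul, smul_eq_mul, mul_one]
  simp only [wirt, h, ContinuousLinearMap.coe_restrictScalars', e]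
  linear_combination (fderiv ℂ g w 1 / 2) * Complex.I_mul_I

/-- In the chain rule for `∂̄` the term with `∂g` carries the factor `∂̄φ = 0`; only the term with
the conjugate of `φ'` survives. -/
theorem wirt_comp_holomorphic {φ : ℂ → ℂ} (hφ : DifferentiableAt ℂ φ w)
    (hg : DifferentiableAt ℝ g (φ w)) :
    wirt Complex.I (fun u => g (φ u)) w
      = wirt Complex.I g (φ w) * (starRingEnd ℂ) (deriv φ w) := by
  have h := (hg.hasFDerivAt.comp w (hφ.hasFDerivAt.restrictScalars ℝ)).fderiv
  have e : (g ∘ φ) = fun u => g (φ u) := rfl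
  rw [e] at h
  have lin : ∀ v : ℂ, fderiv ℝ g (φ w) v
      = v.re * fderiv ℝ g (φ w) 1 + v.im * fderiv ℝ g (φ w) Complex.I := by
    intro v
    conv_lhs => rw [show v = v.re • (1 : ℂ) + v.im • Complex.I by
      simp [Complex.re_add_im]]
    rw [map_add, map_smul, map_smul, Complex.real_smul, Complex.real_smul]
  have e1 : fderiv ℂ φ w 1 = deriv φ w := rfl
  have e2 : fderiv ℂ φ w Complex.I = Complex.I * deriv φ w := by
    rw [← e1, ← smul_eq_mul, ← map_smul, smul_eq_mul, mul_one]
  simp only [wirt, h, ContinuousLinearMap.coe_comp, Function.comp_apply,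
    ContinuousLinearMap.coe_restrictScalars']
  rw [e1, e2, lin (deriv φ w), lin (Complex.I * deriv φ w)]
  have hc : (starRingEnd ℂ) (deriv φ w) = (deriv φ w).re - (deriv φ w).im * Complex.I := by
    apply Complex.ext <;> simp
  rw [hc]
  simp only [Complex.mul_re, Complex.mul_im, Complex.I_re, Complex.I_im]
  push_cast
  linear_combination (-(fderiv ℝ g (φ w) Complex.I) * (-(deriv φ w).im) / 2) * Complex.I_mul_I

theorem wirt_contDiffAt {m n : ℕ∞ω} (hg : ContDiffAt ℝ n g w) (hmn : m + 1 ≤ n) :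
    ContDiffAt ℝ m (wirt c g) w := by
  have h1 : ContDiffAt ℝ m (fderiv ℝ g) w := hg.fderiv_right hmn
  unfold wirt
  fun_prop

end Wirt

/-! ### The connection in the left-invariant frame, and linear algebra of frames. -/

/-- The components in the left-invariant frame of `∇_X Y`, for left-invariant `X` and `Y`. -/
def christoffel {K : Type*} [Field K] (X Y : Fin 3 → K) : Fin 3 → K :=
  ![(X 1 * Y 2 + X 2 * Y 1) / 2, -(X 0 * Y 2 + X 2 * Y 0) / 2, (X 0 * Y 1 - X 1 * Y 0) / 2]

theorem christoffel_zero {K : Type*} [Field K] (X Y : Fin 3 → K) :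
    christoffel X Y 0 = (X 1 * Y 2 + X 2 * Y 1) / 2 := rfl

theorem christoffel_one {K : Type*} [Field K] (X Y : Fin 3 → K) :
    christoffel X Y 1 = -(X 0 * Y 2 + X 2 * Y 0) / 2 := rfl

theorem christoffel_two {K : Type*} [Field K] (X Y : Fin 3 → K) :
    christoffel X Y 2 = (X 0 * Y 1 - X 1 * Y 0) / 2 := rfl

theorem sum_nabla (X Y : Fin 3 → ℝ) (i : Fin 3) :
    ∑ j, ∑ k, X j * Y k * nabla j k i = christoffel X Y i := by
  fin_cases i <;>
    simp [Fin.sum_univ_three, nabla, structConst, lieCoord, basisVec, Ring.lie_def,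
      christoffel] <;> ring

theorem sum_nabla_complex (X Y : Fin 3 → ℂ) (i : Fin 3) :
    ∑ j, ∑ k, X j * Y k * (nabla j k i : ℂ) = christoffel X Y i := by
  fin_cases i <;>
    simp [Fin.sum_univ_three, nabla, structConst, lieCoord, basisVec, Ring.lie_def,
      christoffel] <;> ring

/-- `F` is a smooth conformal immersion of the open subset `U` of the plane. -/
structure IsConformalOn (F : ℂ → Nil) (U : Set ℂ) : Prop where
  isOpen : IsOpen U
  smooth_x : ContDiffOn ℝ ∞ (fun u => (F u).x) U
  smooth_y : ContDiffOn ℝ ∞ (fun u => (F u).y) U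
  smooth_z : ContDiffOn ℝ ∞ (fun u => (F u).z) U
  pos : ∀ w ∈ U, 0 < firstForm F 1 1 w
  eq : ∀ w ∈ U, firstForm F Complex.I Complex.I w = firstForm F 1 1 w
  orthogonal : ∀ w ∈ U, firstForm F 1 Complex.I w = 0

theorem covDeriv_eq (F : ℂ → Nil) (v : ℂ) (W : ℂ → Fin 3 → ℝ) (w : ℂ) (i : Fin 3) :
    covDeriv F v W w i = fderiv ℝ (fun u => W u i) w v + christoffel (vel F v w) (W w) i := by
  simp only [covDeriv, sum_nabla]

/-- Metric compatibility along `F`: the two Christoffel contributions cancel by skew-symmetry. -/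
theorem fderiv_dotProduct (F : ℂ → Nil) (v : ℂ) {W W' : ℂ → Fin 3 → ℝ} {w : ℂ}
    (hW : ∀ i, DifferentiableAt ℝ (fun u => W u i) w)
    (hW' : ∀ i, DifferentiableAt ℝ (fun u => W' u i) w) :
    fderiv ℝ (fun u => W u ⬝ᵥ W' u) w v
      = covDeriv F v W w ⬝ᵥ W' w + W w ⬝ᵥ covDeriv F v W' w := by
  have e : (fun u => W u ⬝ᵥ W' u) = fun u => ∑ i, W u i * W' u i := rfl
  rw [e, fderiv_fun_sum (fun i _ => (hW i).fun_mul (hW' i))]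
  simp only [fderiv_fun_mul (hW _) (hW' _), add_apply, smul_apply, smul_eq_mul,
    dotProduct, Fin.sum_univ_three, covDeriv_eq]
  simp [christoffel]
  ring

theorem fderiv_fderiv_comm {g : ℂ → ℝ} {w : ℂ} (hg : ContDiffAt ℝ ∞ g w) (v v' : ℂ) :
    fderiv ℝ (fun u => fderiv ℝ g u v) w v' = fderiv ℝ (fun u => fderiv ℝ g u v') w v := by
  have h1 : ContDiffAt ℝ ∞ (fderiv ℝ g) w := hg.fderiv_right (by simp)
  have hd : DifferentiableAt ℝ (fderiv ℝ g) w := h1.differentiableAt (by simp)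
  have sym := (hg.isSymmSndFDerivAt (by simpa using (WithTop.coe_le_coe.2 le_top : ((2 : ℕ∞) : ℕ∞ω) ≤ ∞))).eq v v'
  rw [fderiv_clm_apply hd (differentiableAt_const v),
    fderiv_clm_apply hd (differentiableAt_const v')]
  simp [sym]

/-- Orthogonality to `p` and `q` makes `x` parallel to `p × q`, and then `x ⬝ᵥ (p × q) = 0` kills
it. Positivity is replaced by `(p × q) ⬝ᵥ (p × q) ≠ 0`, so that the lemma also applies over `ℂ` to
the isotropic vectors `Z` and `Z̄`. -/
theorem eq_zero_of_orthogonal {K : Type*} [Field K] {p q x : Fin 3 → K}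
    (hc : crossProduct p q ⬝ᵥ crossProduct p q ≠ 0) (hp : x ⬝ᵥ p = 0) (hq : x ⬝ᵥ q = 0)
    (hn : x ⬝ᵥ crossProduct p q = 0) : x = 0 := by
  have cross : crossProduct x (crossProduct p q) = 0 := by
    simp only [cross_apply, dotProduct, Fin.sum_univ_three] at *
    funext i
    fin_cases i <;> simp
    · linear_combination p 0 * hq - q 0 * hp
    · linear_combination p 1 * hq - q 1 * hp
    · linear_combination p 2 * hq - q 2 * hp
  generalize crossProduct p q = c at *
  have c0 := congrFun cross 0
  have c1 := congrFun cross 1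
  have c2 := congrFun cross 2
  simp [cross_apply] at c0 c1 c2
  simp only [dotProduct, Fin.sum_univ_three] at *
  have e0 : (c 0 * c 0 + c 1 * c 1 + c 2 * c 2) * x 0 = 0 := by
    linear_combination c 0 * hn + c 1 * c2 - c 2 * c1
  have e1 : (c 0 * c 0 + c 1 * c 1 + c 2 * c 2) * x 1 = 0 := by
    linear_combination c 1 * hn + c 2 * c0 - c 0 * c2
  have e2 : (c 0 * c 0 + c 1 * c 1 + c 2 * c 2) * x 2 = 0 := by
    linear_combination c 2 * hn + c 0 * c1 - c 1 * c0
  funext i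
  fin_cases i
  · exact (mul_eq_zero.mp e0).resolve_left hc
  · exact (mul_eq_zero.mp e1).resolve_left hc
  · exact (mul_eq_zero.mp e2).resolve_left hc

theorem frame_expansion {p q e : Fin 3 → ℝ} {l : ℝ} (hl : 0 < l) (hp : p ⬝ᵥ p = l)
    (hq : q ⬝ᵥ q = l) (hpq : p ⬝ᵥ q = 0) (hep : e ⬝ᵥ p = 0) (heq : e ⬝ᵥ q = 0) (i : Fin 3) :
    l ^ 2 * e i = (e ⬝ᵥ crossProduct p q) * crossProduct p q i := by
  have hn : crossProduct p q ⬝ᵥ crossProduct p q = l ^ 2 := by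
    rw [cross_dot_cross, hp, hq, hpq]
    ring
  have hnp : crossProduct p q ⬝ᵥ p = 0 := by rw [dotProduct_comm, dot_self_cross]
  have hnq : crossProduct p q ⬝ᵥ q = 0 := by rw [dotProduct_comm, dot_cross_self]
  have key := eq_zero_of_orthogonal (p := p) (q := q)
    (x := l ^ 2 • e - (e ⬝ᵥ crossProduct p q) • crossProduct p q) (by rw [hn]; positivity)
    (by rw [sub_dotProduct, smul_dotProduct, smul_dotProduct, hep, hnp]; simp)
    (by rw [sub_dotProduct, smul_dotProduct, smul_dotProduct, heq, hnq]; simp)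
    (by rw [sub_dotProduct, smul_dotProduct, smul_dotProduct, hn]; simp; ring)
  have := congrFun key i
  simp only [Pi.sub_apply, Pi.smul_apply, smul_eq_mul, Pi.zero_apply] at this
  linarith

/-! ### Torsion, unit normal and mean curvature of a conformal patch. -/

namespace IsConformalOn

variable {F : ℂ → Nil} {U : Set ℂ} {w : ℂ}

theorem contDiffAt_vel (h : IsConformalOn F U) (hw : w ∈ U) (v : ℂ) (k : Fin 3) :
    ContDiffAt ℝ ∞ (fun u => vel F v u k) w := by
  have hU := h.isOpen.mem_nhds hw
  have hx := h.smooth_x.contDiffAt hU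
  have hy := h.smooth_y.contDiffAt hU
  have hz := h.smooth_z.contDiffAt hU
  have hx' : ContDiffAt ℝ ∞ (fderiv ℝ fun u => (F u).x) w := hx.fderiv_right (by simp)
  have hy' : ContDiffAt ℝ ∞ (fderiv ℝ fun u => (F u).y) w := hy.fderiv_right (by simp)
  have hz' : ContDiffAt ℝ ∞ (fderiv ℝ fun u => (F u).z) w := hz.fderiv_right (by simp)
  simp only [vel_eq]
  fin_cases k <;> simp <;> fun_prop

theorem differentiableAt_vel (h : IsConformalOn F U) (hw : w ∈ U) (v : ℂ) (k : Fin 3) :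
    DifferentiableAt ℝ (fun u => vel F v u k) w :=
  (h.contDiffAt_vel hw v k).differentiableAt (by simp)

theorem torsion (h : IsConformalOn F U) (hw : w ∈ U) (v v' : ℂ) :
    covDeriv F v (vel F v') w = covDeriv F v' (vel F v) w := by
  have hU := h.isOpen.mem_nhds hw
  have hx := h.smooth_x.contDiffAt hU
  have hy := h.smooth_y.contDiffAt hU
  have hz := h.smooth_z.contDiffAt hU
  have hy' : ContDiffAt ℝ ∞ (fderiv ℝ fun u => (F u).y) w := hy.fderiv_right (by simp)
  have hz' : ContDiffAt ℝ ∞ (fderiv ℝ fun u => (F u).z) w := hz.fderiv_right (by simp)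
  have dx : DifferentiableAt ℝ (fun u => (F u).x) w := hx.differentiableAt (by simp)
  have dy : ∀ a : ℂ, DifferentiableAt ℝ (fun u => fderiv ℝ (fun u => (F u).y) u a) w := fun a =>
    (hy'.differentiableAt (by simp)).clm_apply (differentiableAt_const a)
  have dz : ∀ a : ℂ, DifferentiableAt ℝ (fun u => fderiv ℝ (fun u => (F u).z) u a) w := fun a =>
    (hz'.differentiableAt (by simp)).clm_apply (differentiableAt_const a)
  -- The coefficient `x` in `dz - x dy` produces a term `dx · dy`; its skew part is what the bracket
  -- `[e₁, e₂] = e₃` compensates.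
  have third : ∀ a b : ℂ, fderiv ℝ (fun u => vel F a u 2) w b
      = fderiv ℝ (fun u => fderiv ℝ (fun u => (F u).z) u a) w b
        - (fderiv ℝ (fun u => (F u).x) w b * fderiv ℝ (fun u => (F u).y) w a
          + (F w).x * fderiv ℝ (fun u => fderiv ℝ (fun u => (F u).y) u a) w b) := by
    intro a b
    have e : (fun u => vel F a u 2) = fun u => fderiv ℝ (fun u => (F u).z) u a
        - (F u).x * fderiv ℝ (fun u => (F u).y) u a := by
      funext u; simp [vel_eq]
    rw [e, fderiv_fun_sub (dz a) (dx.fun_mul (dy a)), fderiv_fun_mul dx (dy a)]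
    simp
    ring
  funext i
  rw [covDeriv_eq, covDeriv_eq]
  fin_cases i
  · have := fderiv_fderiv_comm hx v v'
    simp [vel_eq, christoffel, this]
    ring
  · have := fderiv_fderiv_comm hy v v'
    simp [vel_eq, christoffel, this]
    ring
  · have h1 := fderiv_fderiv_comm hy v v'
    have h2 := fderiv_fderiv_comm hz v v'
    simp [third, h1, h2, christoffel]
    simp [vel_eq]
    ring

theorem normal_eq (h : IsConformalOn F U) (hw : w ∈ U) :
    normal F w = (firstForm F 1 1 w)⁻¹ • crossProduct (vel F 1 w) (vel F Complex.I w) := by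
  have hp := h.pos w hw
  have he := h.eq w hw
  have ho := h.orthogonal w hw
  simp only [normal]
  rw [cross_dot_cross]
  simp only [firstForm] at *
  rw [he, ho, zero_mul, sub_zero, Real.sqrt_mul_self hp.le]

theorem meanCurv_eq (h : IsConformalOn F U) (hw : w ∈ U) :
    meanCurv F w = (secondForm F 1 1 w + secondForm F Complex.I Complex.I w)
      / (2 * firstForm F 1 1 w) := by
  have hp := (h.pos w hw).ne'
  rw [meanCurv, h.eq w hw, h.orthogonal w hw]
  field_simp
  ring

/-- The vector `∇_s f_s + ∇_t f_t` is normal: differentiating `|f_s|² = |f_t|²` and `⟨f_s, f_t⟩ =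
0`, with zero torsion, cancels its tangential components. Its normal component is `2 l H` by the
formula for the trace. -/
theorem laplacian (h : IsConformalOn F U) (hw : w ∈ U) (i : Fin 3) :
    covDeriv F 1 (vel F 1) w i + covDeriv F Complex.I (vel F Complex.I) w i
      = 2 * firstForm F 1 1 w * meanCurv F w * normal F w i := by
  have hp := h.pos w hw
  have he := h.eq w hw
  have ho := h.orthogonal w hw
  have hU := h.isOpen.mem_nhds hw
  have eqn : firstForm F Complex.I Complex.I =ᶠ[nhds w] firstForm F 1 1 := by
    filter_upwards [hU] with u hu using h.eq u hu
  have orth : firstForm F 1 Complex.I =ᶠ[nhds w] fun _ => 0 := by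
    filter_upwards [hU] with u hu using h.orthogonal u hu
  have met : ∀ v a b : ℂ, fderiv ℝ (firstForm F a b) w v
      = covDeriv F v (vel F a) w ⬝ᵥ vel F b w + vel F a w ⬝ᵥ covDeriv F v (vel F b) w :=
    fun v a b => fderiv_dotProduct F v (h.differentiableAt_vel hw a) (h.differentiableAt_vel hw b)
  have tor := h.torsion hw 1 Complex.I
  have e1 := met 1 1 1
  have e2 := met 1 Complex.I Complex.I
  have e3 := met Complex.I 1 1
  have e4 := met Complex.I Complex.I Complex.I
  have e5 := met 1 1 Complex.I
  have e6 := met Complex.I 1 Complex.I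
  rw [eqn.fderiv_eq] at e2 e4
  rw [orth.fderiv_eq] at e5 e6
  simp only [fderiv_fun_const, Pi.zero_apply, zero_apply, tor] at e1 e2 e3 e4 e5 e6
  have frame := frame_expansion (e := covDeriv F 1 (vel F 1) w
    + covDeriv F Complex.I (vel F Complex.I) w) hp rfl he ho
    (by
      rw [add_dotProduct]
      simp only [dotProduct, Fin.sum_univ_three] at *
      linarith)
    (by
      rw [add_dotProduct]
      simp only [dotProduct, Fin.sum_univ_three] at *
      linarith) i
  have hn := h.normal_eq hw
  have hm := h.meanCurv_eq hw
  simp only [secondForm, ← add_dotProduct] at hm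
  rw [hn] at hm ⊢
  rw [hm, dotProduct_smul]
  simp only [Pi.add_apply, Pi.smul_apply, smul_eq_mul] at frame ⊢
  field_simp
  linear_combination frame

end IsConformalOn

/-! ### Pointwise algebra behind the Codazzi equation. -/

/-- With `B = Z̄`, the left side is `⟨R(Z̄, Z)Z, N⟩` for the curvature tensor `R` of `Nil`, expanded
in a left-invariant frame with `[X, Y] = ∇_X Y - ∇_Y X`. -/
theorem curvature_term {Z B N : Fin 3 → ℂ} {l : ℂ} (hZZ : Z ⬝ᵥ Z = 0) (hZB : Z ⬝ᵥ B = l / 2)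
    (hZN : Z ⬝ᵥ N = 0) (hBN : B ⬝ᵥ N = 0)
    (hc : Z 0 * B 1 - Z 1 * B 0 = Complex.I * l / 2 * N 2)
    (hNZ : N 0 * Z 1 - N 1 * Z 0 = Complex.I * Z 2) :
    N ⬝ᵥ (christoffel (christoffel Z B) Z + christoffel B (christoffel Z Z)
      - christoffel (christoffel B Z) Z - christoffel Z (christoffel B Z))
      = -(l * N 2 * Z 2) / 2 := by
  simp only [christoffel_zero, christoffel_one, christoffel_two, dotProduct, Fin.sum_univ_three,
      Pi.add_apply, Pi.sub_apply] at *
  linear_combination (N 0 * Z 1 - N 1 * Z 0) / 2 * hc + Complex.I * l * N 2 / 4 * hNZ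
    + l * N 2 * Z 2 / 4 * Complex.I_mul_I - Z 2 * B 2 / 2 * hZN - Z 2 * N 2 / 2 * hZB
    - ((B 0 * Z 1 - B 1 * Z 0) / 2 * hNZ - Complex.I * Z 2 / 2 * hc
      - l * N 2 * Z 2 / 4 * Complex.I_mul_I
      - Z 2 / 2 * (Z 2 * hBN + B 2 * hZN) - N 2 / 2 * (Z 2 * hZB + B 2 * hZZ)) / 2

/-- `B` stands for `Z̄`; the prefixes `d` and `b` stand for `∂` and `∂̄`. The left side is `∂̄A`
once `∂̄∂Z` has been rewritten as `∂∂̄Z`. Treating all derivatives as independent symbols reduces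
the Codazzi equation to polynomial algebra. -/
theorem codazzi_algebra {Z B N dZ bZ dB dN bN : Fin 3 → ℂ} {l H A dl dH : ℂ} (hl : l ≠ 0)
    (hZZ : Z ⬝ᵥ Z = 0) (hZB : Z ⬝ᵥ B = l / 2)
    (hZN : Z ⬝ᵥ N = 0) (hBN : B ⬝ᵥ N = 0) (hNN : N ⬝ᵥ N = 1)
    (hc : crossProduct Z B = (Complex.I * l / 2) • N)
    (hNZ : N 0 * Z 1 - N 1 * Z 0 = Complex.I * Z 2)
    (hbZ : bZ = (l * H / 2) • N - christoffel B Z)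
    (hdB : dB = (l * H / 2) • N - christoffel Z B)
    (hdZZ : dZ ⬝ᵥ Z = 0) (hdZB : dZ ⬝ᵥ B + Z ⬝ᵥ dB = dl / 2)
    (hA : A = (dZ + christoffel Z Z) ⬝ᵥ N)
    (hdN : dN ⬝ᵥ N = 0) (hbN : bN ⬝ᵥ N = 0) (hbZN : bZ ⬝ᵥ N + Z ⬝ᵥ bN = 0) :
    (((dl * H + l * dH) / 2) • N + (l * H / 2) • dN - christoffel dB Z - christoffel B dZ
      + christoffel bZ Z + christoffel Z bZ) ⬝ᵥ N + (dZ + christoffel Z Z) ⬝ᵥ bN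
      = l * dH / 2 - l * N 2 * Z 2 / 2 := by
  have hc2 : Z 0 * B 1 - Z 1 * B 0 = Complex.I * l / 2 * N 2 := by
    have := congrFun hc 2
    simpa [cross_apply] using this
  have curv := curvature_term hZZ hZB hZN hBN hc2 hNZ
  -- For `l = e^{2α}`, `m` is `2 ∂α`.
  obtain ⟨m, rfl⟩ : ∃ m, dl = m * l := ⟨dl / l, by field_simp⟩
  -- The Gauss formula `∇_∂ Z = m Z + A N`: there is no `Z̄`-component because `⟨∂Z, Z⟩ = 0`.
  have expansion : dZ = m • Z + A • N - christoffel Z Z := by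
    have key := eq_zero_of_orthogonal (p := Z) (q := B)
      (x := dZ + christoffel Z Z - m • Z - A • N)
      (by
        rw [hc, smul_dotProduct, dotProduct_smul, hNN]
        simp [hl])
      (by
        simp only [christoffel_zero, christoffel_one, christoffel_two, dotProduct, Fin.sum_univ_three,
      Pi.add_apply, Pi.sub_apply, Pi.smul_apply, smul_eq_mul] at *
        linear_combination hdZZ - m * hZZ - A * hZN)
      (by
        rw [hdB] at hdZB
        simp only [christoffel_zero, christoffel_one, christoffel_two, dotProduct, Fin.sum_univ_three,
      Pi.add_apply, Pi.sub_apply, Pi.smul_apply, smul_eq_mul] at *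
        linear_combination hdZB - m * hZB - A * hBN - l * H / 2 * hZN)
      (by
        rw [hc, dotProduct_smul]
        simp only [christoffel_zero, christoffel_one, christoffel_two, dotProduct, Fin.sum_univ_three,
      Pi.add_apply, Pi.sub_apply, Pi.smul_apply, smul_eq_mul] at *
        linear_combination (Complex.I * l / 2) * (-hA - m * hZN - A * hNN))
    funext i
    have := congrFun key i
    simp only [Pi.add_apply, Pi.sub_apply, Pi.smul_apply, smul_eq_mul, Pi.zero_apply] at this ⊢
    linear_combination this
  have hx : (dZ + christoffel Z Z) ⬝ᵥ bN = -m * (bZ ⬝ᵥ N) := by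
    rw [expansion]
    simp [dotProduct, Fin.sum_univ_three] at *
    linear_combination m * hbZN + A * hbN
  rw [hx, hbZ, hdB, expansion]
  simp only [christoffel_zero, christoffel_one, christoffel_two, dotProduct, Fin.sum_univ_three,
      Pi.add_apply, Pi.sub_apply, Pi.smul_apply, smul_eq_mul] at *
  linear_combination curv + l * dH / 2 * hNN + l * H / 2 * hdN

/-! ### Scalar and cross products of `Z`, `Z̄` and `N`. -/

namespace IsConformalOn

variable {F : ℂ → Nil} {U : Set ℂ} {w : ℂ}

theorem normal_dot_self (h : IsConformalOn F U) (hw : w ∈ U) : normal F w ⬝ᵥ normal F w = 1 := by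
  have hp := (h.pos w hw).ne'
  have he := h.eq w hw
  have ho := h.orthogonal w hw
  rw [h.normal_eq hw, smul_dotProduct, dotProduct_smul, cross_dot_cross]
  simp only [firstForm] at *
  rw [he, ho]
  simp
  field_simp

theorem vel_dot_normal (h : IsConformalOn F U) (hw : w ∈ U) :
    vel F 1 w ⬝ᵥ normal F w = 0 ∧ vel F Complex.I w ⬝ᵥ normal F w = 0 := by
  rw [h.normal_eq hw, dotProduct_smul, dotProduct_smul, dot_self_cross, dot_cross_self]
  simp

end IsConformalOn

/-- The conjugate `Z̄`. -/
def Zbar (F : ℂ → Nil) (k : Fin 3) (w : ℂ) : ℂ := (starRingEnd ℂ) (Z F k w)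

theorem Zbar_eq (F : ℂ → Nil) (k : Fin 3) (w : ℂ) :
    Zbar F k w = ((vel F 1 w k : ℂ) + Complex.I * (vel F Complex.I w k : ℂ)) / 2 := by
  simp [Zbar, Z, map_ofNat]

namespace IsConformalOn

variable {F : ℂ → Nil} {U : Set ℂ} {w : ℂ}

theorem Z_dot_Z (h : IsConformalOn F U) (hw : w ∈ U) :
    (fun k => Z F k w) ⬝ᵥ (fun k => Z F k w) = 0 := by
  have he : ((firstForm F Complex.I Complex.I w : ℝ) : ℂ) = (firstForm F 1 1 w : ℝ) := by
    rw [h.eq w hw]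
  have ho : ((firstForm F 1 Complex.I w : ℝ) : ℂ) = 0 := by rw [h.orthogonal w hw]; simp
  simp only [firstForm, dotProduct, Fin.sum_univ_three, Z] at *
  push_cast at *
  linear_combination (-1 / 4) * he - Complex.I / 2 * ho
    + ((vel F Complex.I w 0 : ℂ) ^ 2 + (vel F Complex.I w 1 : ℂ) ^ 2
      + (vel F Complex.I w 2 : ℂ) ^ 2) / 4 * Complex.I_mul_I

theorem Z_dot_Zbar (h : IsConformalOn F U) (hw : w ∈ U) :
    (fun k => Z F k w) ⬝ᵥ (fun k => Zbar F k w) = (firstForm F 1 1 w : ℂ) / 2 := by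
  have he : ((firstForm F Complex.I Complex.I w : ℝ) : ℂ) = (firstForm F 1 1 w : ℝ) := by
    rw [h.eq w hw]
  simp only [firstForm, dotProduct, Fin.sum_univ_three, Z, Zbar_eq] at *
  push_cast at *
  linear_combination (1 / 4) * he
    - ((vel F Complex.I w 0 : ℂ) ^ 2 + (vel F Complex.I w 1 : ℂ) ^ 2
      + (vel F Complex.I w 2 : ℂ) ^ 2) / 4 * Complex.I_mul_I

theorem Z_dot_normal (h : IsConformalOn F U) (hw : w ∈ U) :
    (fun k => Z F k w) ⬝ᵥ (fun k => (normal F w k : ℂ)) = 0 := by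
  obtain ⟨h1, h2⟩ := h.vel_dot_normal hw
  have h1 : ((vel F 1 w ⬝ᵥ normal F w : ℝ) : ℂ) = 0 := by simp [h1]
  have h2 : ((vel F Complex.I w ⬝ᵥ normal F w : ℝ) : ℂ) = 0 := by simp [h2]
  simp only [dotProduct, Fin.sum_univ_three, Z] at *
  push_cast at *
  linear_combination (1 / 2) * h1 - Complex.I / 2 * h2

theorem Zbar_dot_normal (h : IsConformalOn F U) (hw : w ∈ U) :
    (fun k => Zbar F k w) ⬝ᵥ (fun k => (normal F w k : ℂ)) = 0 := by
  obtain ⟨h1, h2⟩ := h.vel_dot_normal hw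
  have h1 : ((vel F 1 w ⬝ᵥ normal F w : ℝ) : ℂ) = 0 := by simp [h1]
  have h2 : ((vel F Complex.I w ⬝ᵥ normal F w : ℝ) : ℂ) = 0 := by simp [h2]
  simp only [dotProduct, Fin.sum_univ_three, Zbar_eq] at *
  push_cast at *
  linear_combination (1 / 2) * h1 + Complex.I / 2 * h2

theorem normal_dot_normal (h : IsConformalOn F U) (hw : w ∈ U) :
    (fun k => (normal F w k : ℂ)) ⬝ᵥ (fun k => (normal F w k : ℂ)) = 1 := by
  have h1 : ((normal F w ⬝ᵥ normal F w : ℝ) : ℂ) = 1 := by simp [h.normal_dot_self hw]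
  simp only [dotProduct, Fin.sum_univ_three] at *
  push_cast at *
  exact h1

theorem cross_vel (h : IsConformalOn F U) (hw : w ∈ U) :
    crossProduct (vel F 1 w) (vel F Complex.I w) = firstForm F 1 1 w • normal F w := by
  rw [h.normal_eq hw, smul_smul, mul_inv_cancel₀ (h.pos w hw).ne', one_smul]

theorem Z_cross_Zbar (h : IsConformalOn F U) (hw : w ∈ U) :
    crossProduct (fun k => Z F k w) (fun k => Zbar F k w)
      = (Complex.I * (firstForm F 1 1 w : ℂ) / 2) • (fun k => (normal F w k : ℂ)) := by
  have hc := h.cross_vel hw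
  have hi : ∀ i, ((crossProduct (vel F 1 w) (vel F Complex.I w) i : ℝ) : ℂ)
      = (firstForm F 1 1 w : ℝ) * (normal F w i : ℝ) := by
    intro i; rw [hc]; simp
  funext i
  have hi := hi i
  fin_cases i <;> simp [cross_apply, Z, Zbar_eq] at hi ⊢ <;>
    linear_combination (Complex.I / 2) * hi

/-- Third component of `N × Z = iZ`: the map `N × ·` is the quarter turn of the tangent plane,
taking `f_s` to `f_t` and `f_t` to `-f_s`. -/
theorem normal_cross_Z (h : IsConformalOn F U) (hw : w ∈ U) :
    (normal F w 0 : ℂ) * Z F 1 w - (normal F w 1 : ℂ) * Z F 0 w = Complex.I * Z F 2 w := by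
  have hl : (firstForm F 1 1 w : ℂ) ≠ 0 := by exact_mod_cast (h.pos w hw).ne'
  have hc := h.cross_vel hw
  have hi : ∀ i, ((crossProduct (vel F 1 w) (vel F Complex.I w) i : ℝ) : ℂ)
      = (firstForm F 1 1 w : ℝ) * (normal F w i : ℝ) := by
    intro i; rw [hc]; simp
  have h0 := hi 0
  have h1 := hi 1
  have hp : ((firstForm F 1 1 w : ℝ) : ℂ) = (vel F 1 w ⬝ᵥ vel F 1 w : ℝ) := rfl
  have he : ((firstForm F 1 1 w : ℝ) : ℂ) = (vel F Complex.I w ⬝ᵥ vel F Complex.I w : ℝ) := by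
    rw [← h.eq w hw]; rfl
  have ho : ((vel F 1 w ⬝ᵥ vel F Complex.I w : ℝ) : ℂ) = 0 := by
    have := h.orthogonal w hw
    simp only [firstForm] at this
    rw [this]; simp
  apply mul_left_cancel₀ hl
  generalize ((firstForm F 1 1 w : ℝ) : ℂ) = l at *
  simp [-mul_eq_mul_left_iff, cross_apply, dotProduct, Fin.sum_univ_three, Z] at *
  generalize (vel F 1 w 0 : ℂ) = p0 at *
  generalize (vel F 1 w 1 : ℂ) = p1 at *
  generalize (vel F 1 w 2 : ℂ) = p2 at *
  generalize (vel F Complex.I w 0 : ℂ) = q0 at *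
  generalize (vel F Complex.I w 1 : ℂ) = q1 at *
  generalize (vel F Complex.I w 2 : ℂ) = q2 at *
  linear_combination (-(p1 - Complex.I * q1) / 2) * h0 + (p0 - Complex.I * q0) / 2 * h1
    - (Complex.I * p2 / 2) * he - q2 / 2 * hp - (p2 + Complex.I * q2) / 2 * ho
    + l * q2 / 2 * Complex.I_mul_I

end IsConformalOn

theorem ContDiffAt.ofReal {g : ℂ → ℝ} {w : ℂ} {n : ℕ∞ω} (hg : ContDiffAt ℝ n g w) :
    ContDiffAt ℝ n (fun u => (g u : ℂ)) w :=
  Complex.ofRealCLM.contDiff.contDiffAt.comp w hg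

/-! ### Smoothness, structure equations and the Codazzi equation. -/

namespace IsConformalOn

variable {F : ℂ → Nil} {U : Set ℂ} {w : ℂ}

theorem contDiffAt_Z (h : IsConformalOn F U) (hw : w ∈ U) (k : Fin 3) :
    ContDiffAt ℝ ∞ (Z F k) w := by
  have h1 := ContDiffAt.ofReal (h.contDiffAt_vel hw 1 k)
  have h2 := ContDiffAt.ofReal (h.contDiffAt_vel hw Complex.I k)
  unfold Z
  fun_prop

theorem contDiffAt_Zbar (h : IsConformalOn F U) (hw : w ∈ U) (k : Fin 3) :
    ContDiffAt ℝ ∞ (Zbar F k) w :=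
  Complex.conjCLE.contDiff.contDiffAt.comp w (h.contDiffAt_Z hw k)

theorem contDiffAt_firstForm (h : IsConformalOn F U) (hw : w ∈ U) (a b : ℂ) :
    ContDiffAt ℝ ∞ (firstForm F a b) w := by
  have e : firstForm F a b = fun u => ∑ k, vel F a u k * vel F b u k := rfl
  rw [e]
  exact ContDiffAt.sum fun k _ => (h.contDiffAt_vel hw a k).mul (h.contDiffAt_vel hw b k)

theorem contDiffAt_normal (h : IsConformalOn F U) (hw : w ∈ U) (k : Fin 3) :
    ContDiffAt ℝ ∞ (fun u => normal F u k) w := by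
  have e : (fun u => normal F u k) =ᶠ[nhds w] fun u => (firstForm F 1 1 u)⁻¹
      * crossProduct (vel F 1 u) (vel F Complex.I u) k := by
    filter_upwards [h.isOpen.mem_nhds hw] with u hu
    rw [h.normal_eq hu]
    rfl
  refine ContDiffAt.congr_of_eventuallyEq ?_ e
  refine ((h.contDiffAt_firstForm hw 1 1).inv (h.pos w hw).ne').mul ?_
  have hp := h.contDiffAt_vel hw 1
  have hq := h.contDiffAt_vel hw Complex.I
  simp only [cross_apply]
  fin_cases k <;> exact ((hp _).mul (hq _)).sub ((hp _).mul (hq _))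

theorem contDiffAt_secondForm (h : IsConformalOn F U) (hw : w ∈ U) (a b : ℂ) :
    ContDiffAt ℝ ∞ (secondForm F a b) w := by
  have e : secondForm F a b = fun u => ∑ k, covDeriv F a (vel F b) u k * normal F u k := rfl
  rw [e]
  refine ContDiffAt.sum fun k _ => ContDiffAt.mul ?_ (h.contDiffAt_normal hw k)
  simp only [covDeriv]
  have hd : ContDiffAt ℝ ∞ (fderiv ℝ fun u => vel F b u k) w :=
    (h.contDiffAt_vel hw b k).fderiv_right (by simp)
  refine ContDiffAt.add (by fun_prop) ?_
  exact ContDiffAt.sum fun i _ => ContDiffAt.sum fun j _ =>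
    ((h.contDiffAt_vel hw a i).mul (h.contDiffAt_vel hw b j)).mul contDiffAt_const

theorem contDiffAt_meanCurv (h : IsConformalOn F U) (hw : w ∈ U) :
    ContDiffAt ℝ ∞ (meanCurv F) w := by
  have e : meanCurv F =ᶠ[nhds w] fun u => (secondForm F 1 1 u + secondForm F Complex.I Complex.I u)
      / (2 * firstForm F 1 1 u) := by
    filter_upwards [h.isOpen.mem_nhds hw] with u hu using h.meanCurv_eq hu
  refine ContDiffAt.congr_of_eventuallyEq ?_ e
  refine ContDiffAt.div ((h.contDiffAt_secondForm hw _ _).add (h.contDiffAt_secondForm hw _ _))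
    (contDiffAt_const.mul (h.contDiffAt_firstForm hw 1 1)) ?_
  have := h.pos w hw
  positivity

/-- Since `4 ∇_∂̄ ∂f = (∇_s f_s + ∇_t f_t) + i (∇_t f_s - ∇_s f_t)`, this combines `laplacian` with
`torsion`. -/
theorem dbar_Z (h : IsConformalOn F U) (hw : w ∈ U) (k : Fin 3) :
    wirt Complex.I (Z F k) w
      = (firstForm F 1 1 w : ℂ) * (meanCurv F w : ℂ) / 2 * (normal F w k : ℂ)
        - christoffel (fun i => Zbar F i w) (fun i => Z F i w) k := by
  have dp := h.differentiableAt_vel hw 1 k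
  have dq := h.differentiableAt_vel hw Complex.I k
  have dp' : DifferentiableAt ℝ (fun u => (vel F 1 u k : ℂ)) w :=
    Complex.ofRealCLM.differentiableAt.comp w dp
  have dq' : DifferentiableAt ℝ (fun u => (vel F Complex.I u k : ℂ)) w :=
    Complex.ofRealCLM.differentiableAt.comp w dq
  have e : Z F k = fun u => (1 / 2 : ℂ) * ((vel F 1 u k : ℂ)
      - Complex.I * (vel F Complex.I u k : ℂ)) := by
    funext u; simp only [Z]; ring
  have hw1 : wirt Complex.I (Z F k) w = (1 / 2 : ℂ) * (
      ((fderiv ℝ (fun u => vel F 1 u k) w 1 : ℝ)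
        + Complex.I * (fderiv ℝ (fun u => vel F 1 u k) w Complex.I : ℝ)) / 2
      - Complex.I * (((fderiv ℝ (fun u => vel F Complex.I u k) w 1 : ℝ)
        + Complex.I * (fderiv ℝ (fun u => vel F Complex.I u k) w Complex.I : ℝ)) / 2)) := by
    rw [e, wirt_const_mul _ (dp'.fun_sub (dq'.const_mul _)), wirt_sub dp' (dq'.const_mul _),
      wirt_const_mul _ dq', wirt_ofReal dp, wirt_ofReal dq]
  have lap := h.laplacian hw k
  have tor := congrFun (h.torsion hw 1 Complex.I) k
  rw [covDeriv_eq, covDeriv_eq] at lap tor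
  have lap' := congrArg (fun r : ℝ => (r : ℂ)) lap
  have tor' := congrArg (fun r : ℝ => (r : ℂ)) tor
  rw [hw1]
  generalize fderiv ℝ (fun u => vel F 1 u k) w 1 = a at *
  generalize fderiv ℝ (fun u => vel F 1 u k) w Complex.I = b at *
  generalize fderiv ℝ (fun u => vel F Complex.I u k) w 1 = c at *
  generalize fderiv ℝ (fun u => vel F Complex.I u k) w Complex.I = d at *
  have hG : christoffel (fun i => Zbar F i w) (fun i => Z F i w) k
      = ((christoffel (vel F 1 w) (vel F 1 w) k : ℝ)
        + (christoffel (vel F Complex.I w) (vel F Complex.I w) k : ℝ)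
        + Complex.I * ((christoffel (vel F Complex.I w) (vel F 1 w) k : ℝ)
          - (christoffel (vel F 1 w) (vel F Complex.I w) k : ℝ))) / 4 := by
    fin_cases k <;> simp [christoffel, Z, Zbar_eq] <;> ring_nf <;> simp <;> ring
  rw [hG]
  push_cast at lap' tor'
  linear_combination (1 / 4) * lap' - Complex.I / 4 * tor' - (d : ℂ) / 4 * Complex.I_mul_I

theorem dd_Zbar (h : IsConformalOn F U) (hw : w ∈ U) (k : Fin 3) :
    wirt (-Complex.I) (Zbar F k) w
      = (firstForm F 1 1 w : ℂ) * (meanCurv F w : ℂ) / 2 * (normal F w k : ℂ)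
        - christoffel (fun i => Z F i w) (fun i => Zbar F i w) k := by
  have e : Zbar F k = fun u => (starRingEnd ℂ) (Z F k u) := rfl
  rw [e, wirt_conj ((h.contDiffAt_Z hw k).differentiableAt (by simp))]
  simp only [map_neg, Complex.conj_I, neg_neg]
  rw [h.dbar_Z hw k]
  fin_cases k <;> simp [christoffel, Zbar, map_ofNat]

theorem wirt_christoffel {c : ℂ} {X Y : Fin 3 → ℂ → ℂ} (hX : ∀ i, DifferentiableAt ℝ (X i) w)
    (hY : ∀ i, DifferentiableAt ℝ (Y i) w) (k : Fin 3) :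
    wirt c (fun u => christoffel (fun i => X i u) (fun i => Y i u) k) w
      = (christoffel (fun i => wirt c (X i) w) (fun i => Y i w)
        + christoffel (fun i => X i w) (fun i => wirt c (Y i) w)) k := by
  have hXY : ∀ i j, DifferentiableAt ℝ (fun u => X i u * Y j u) w := fun i j =>
    (hX i).fun_mul (hY j)
  have e0 : (fun u => christoffel (fun i => X i u) (fun i => Y i u) 0)
      = fun u => (1 / 2 : ℂ) * (X 1 u * Y 2 u + X 2 u * Y 1 u) := by
    funext u; simp only [christoffel_zero]; ring
  have e1 : (fun u => christoffel (fun i => X i u) (fun i => Y i u) 1)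
      = fun u => (-1 / 2 : ℂ) * (X 0 u * Y 2 u + X 2 u * Y 0 u) := by
    funext u; simp only [christoffel_one]; ring
  have e2 : (fun u => christoffel (fun i => X i u) (fun i => Y i u) 2)
      = fun u => (1 / 2 : ℂ) * (X 0 u * Y 1 u - X 1 u * Y 0 u) := by
    funext u; simp only [christoffel_two]; ring
  rw [Pi.add_apply]
  fin_cases k
  · simp only [Fin.zero_eta]
    rw [e0, wirt_const_mul _ ((hXY 1 2).fun_add (hXY 2 1)), wirt_add (hXY 1 2) (hXY 2 1),
      wirt_mul (hX _) (hY _), wirt_mul (hX _) (hY _), christoffel_zero, christoffel_zero]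
    ring
  · simp only [Fin.mk_one]
    rw [e1, wirt_const_mul _ ((hXY 0 2).fun_add (hXY 2 0)), wirt_add (hXY 0 2) (hXY 2 0),
      wirt_mul (hX _) (hY _), wirt_mul (hX _) (hY _), christoffel_one, christoffel_one]
    ring
  · simp only [Fin.reduceFinMk]
    rw [e2, wirt_const_mul _ ((hXY 0 1).fun_sub (hXY 1 0)), wirt_sub (hXY 0 1) (hXY 1 0),
      wirt_mul (hX _) (hY _), wirt_mul (hX _) (hY _), christoffel_two, christoffel_two]
    ring

theorem wirt_dotProduct {c : ℂ} {X Y : Fin 3 → ℂ → ℂ} (hX : ∀ i, DifferentiableAt ℝ (X i) w)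
    (hY : ∀ i, DifferentiableAt ℝ (Y i) w) :
    wirt c (fun u => (fun i => X i u) ⬝ᵥ (fun i => Y i u)) w
      = (fun i => wirt c (X i) w) ⬝ᵥ (fun i => Y i w)
        + (fun i => X i w) ⬝ᵥ (fun i => wirt c (Y i) w) := by
  simp only [dotProduct]
  rw [wirt_sum _ fun i _ => (hX i).fun_mul (hY i)]
  simp only [wirt_mul (hX _) (hY _), Finset.sum_add_distrib]

theorem dbar_hopfCoeff (h : IsConformalOn F U) (hw : w ∈ U) :
    wirt Complex.I (hopfCoeff F) w
      = (firstForm F 1 1 w : ℂ) * wirt (-Complex.I) (fun u => (meanCurv F u : ℂ)) w / 2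
        - (firstForm F 1 1 w : ℂ) * (normal F w 2 : ℂ) * Z F 2 w / 2 := by
  have hU := h.isOpen.mem_nhds hw
  have sZ := h.contDiffAt_Z hw
  have dZ : ∀ k, DifferentiableAt ℝ (Z F k) w := fun k => (sZ k).differentiableAt (by simp)
  have dB : ∀ k, DifferentiableAt ℝ (Zbar F k) w := fun k =>
    (h.contDiffAt_Zbar hw k).differentiableAt (by simp)
  have dN : ∀ k, DifferentiableAt ℝ (fun u => (normal F u k : ℂ)) w := fun k =>
    (ContDiffAt.ofReal (h.contDiffAt_normal hw k)).differentiableAt (by simp)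
  have dL : DifferentiableAt ℝ (fun u => (firstForm F 1 1 u : ℂ)) w :=
    (ContDiffAt.ofReal (h.contDiffAt_firstForm hw 1 1)).differentiableAt (by simp)
  have dH : DifferentiableAt ℝ (fun u => (meanCurv F u : ℂ)) w :=
    (ContDiffAt.ofReal (h.contDiffAt_meanCurv hw)).differentiableAt (by simp)
  have dZ' : ∀ k, DifferentiableAt ℝ (wirt (-Complex.I) (Z F k)) w := fun k =>
    (wirt_contDiffAt (m := ∞) (sZ k) (by simp)).differentiableAt (by simp)
  have dG : ∀ k, DifferentiableAt ℝ
      (fun u => christoffel (fun i => Z F i u) (fun i => Z F i u) k) w := by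
    intro k
    fin_cases k <;> simp [christoffel] <;> fun_prop
  have dG' : ∀ k, DifferentiableAt ℝ
      (fun u => christoffel (fun i => Zbar F i u) (fun i => Z F i u) k) w := by
    intro k
    fin_cases k <;> simp [christoffel] <;> fun_prop
  have hopf : hopfCoeff F = fun u => (fun i => wirt (-Complex.I) (Z F i) u
      + christoffel (fun i => Z F i u) (fun i => Z F i u) i)
      ⬝ᵥ (fun i => (normal F u i : ℂ)) := by
    funext u
    simp only [hopfCoeff, sum_nabla_complex _ _ _, wirtinger_eq_wirt]
    rfl
  -- Commuting `∂̄` with `∂` allows the structure equation `dbar_Z` to be differentiated in place of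
  -- the unknown `∂Z`.
  have second : ∀ k, wirt Complex.I (wirt (-Complex.I) (Z F k)) w
      = (wirt (-Complex.I) (fun u => (firstForm F 1 1 u : ℂ)) w * (meanCurv F w : ℂ)
        + (firstForm F 1 1 w : ℂ) * wirt (-Complex.I) (fun u => (meanCurv F u : ℂ)) w) / 2
          * (normal F w k : ℂ)
        + (firstForm F 1 1 w : ℂ) * (meanCurv F w : ℂ) / 2
          * wirt (-Complex.I) (fun u => (normal F u k : ℂ)) w
        - (christoffel (fun i => wirt (-Complex.I) (Zbar F i) w) (fun i => Z F i w)
          + christoffel (fun i => Zbar F i w) (fun i => wirt (-Complex.I) (Z F i) w)) k := by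
    intro k
    rw [wirt_comm ((sZ k).of_le (by simpa using
      (WithTop.coe_le_coe.2 le_top : ((2 : ℕ∞) : ℕ∞ω) ≤ ∞)))]
    have e : wirt Complex.I (Z F k) =ᶠ[nhds w] fun u =>
        (1 / 2 : ℂ) * ((firstForm F 1 1 u : ℂ) * (meanCurv F u : ℂ) * (normal F u k : ℂ))
        - christoffel (fun i => Zbar F i u) (fun i => Z F i u) k := by
      filter_upwards [hU] with u hu
      rw [h.dbar_Z hu k]
      ring
    rw [wirt_congr e, wirt_sub (((dL.fun_mul dH).fun_mul (dN k)).const_mul _) (dG' k),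
      wirt_const_mul _ ((dL.fun_mul dH).fun_mul (dN k)), wirt_mul (dL.fun_mul dH) (dN k),
      wirt_mul dL dH, wirt_christoffel dB dZ]
    ring
  -- Leibniz rule for a scalar product that is constant on `U`.
  have orth : ∀ (c : ℂ) {X Y : Fin 3 → ℂ → ℂ} {a : ℂ} (_ : ∀ i, DifferentiableAt ℝ (X i) w)
      (_ : ∀ i, DifferentiableAt ℝ (Y i) w)
      (_ : ∀ u ∈ U, (fun i => X i u) ⬝ᵥ (fun i => Y i u) = a),
      (fun i => wirt c (X i) w) ⬝ᵥ (fun i => Y i w)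
        + (fun i => X i w) ⬝ᵥ (fun i => wirt c (Y i) w) = 0 := by
    intro c X Y a hX hY hXY
    rw [← wirt_dotProduct hX hY, ← wirt_const (c := c) (w := w) a]
    apply wirt_congr
    filter_upwards [hU] with u hu using hXY u hu
  have hNN : ∀ c, (fun i => wirt c (fun u => (normal F u i : ℂ)) w)
      ⬝ᵥ (fun i => (normal F w i : ℂ)) = 0 := by
    intro c
    have := orth c dN dN (fun u hu => h.normal_dot_normal hu)
    rw [dotProduct_comm (fun i => (normal F w i : ℂ))] at this
    exact add_self_eq_zero.mp this
  have hZZ : (fun i => wirt (-Complex.I) (Z F i) w) ⬝ᵥ (fun i => Z F i w) = 0 := by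
    have := orth (-Complex.I) dZ dZ (fun u hu => h.Z_dot_Z hu)
    rw [dotProduct_comm (fun i => Z F i w)] at this
    exact add_self_eq_zero.mp this
  have hZB : (fun i => wirt (-Complex.I) (Z F i) w) ⬝ᵥ (fun i => Zbar F i w)
      + (fun i => Z F i w) ⬝ᵥ (fun i => wirt (-Complex.I) (Zbar F i) w)
      = wirt (-Complex.I) (fun u => (firstForm F 1 1 u : ℂ)) w / 2 := by
    rw [← wirt_dotProduct dZ dB]
    have e : (fun u => (fun i => Z F i u) ⬝ᵥ (fun i => Zbar F i u)) =ᶠ[nhds w]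
        fun u => (1 / 2 : ℂ) * (firstForm F 1 1 u : ℂ) := by
      filter_upwards [hU] with u hu
      rw [h.Z_dot_Zbar hu]
      ring
    rw [wirt_congr e, wirt_const_mul _ dL]
    ring
  have hbZ : (fun i => wirt Complex.I (Z F i) w)
      = ((firstForm F 1 1 w : ℂ) * (meanCurv F w : ℂ) / 2) • (fun i => (normal F w i : ℂ))
        - christoffel (fun i => Zbar F i w) (fun i => Z F i w) := by
    funext k
    rw [h.dbar_Z hw k]
    rfl
  have hdB : (fun i => wirt (-Complex.I) (Zbar F i) w)
      = ((firstForm F 1 1 w : ℂ) * (meanCurv F w : ℂ) / 2) • (fun i => (normal F w i : ℂ))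
        - christoffel (fun i => Z F i w) (fun i => Zbar F i w) := by
    funext k
    rw [h.dd_Zbar hw k]
    rfl
  have key := codazzi_algebra (H := (meanCurv F w : ℂ))
    (dH := wirt (-Complex.I) (fun u => (meanCurv F u : ℂ)) w)
    (l := (firstForm F 1 1 w : ℂ)) (by exact_mod_cast (h.pos w hw).ne')
    (h.Z_dot_Z hw) (h.Z_dot_Zbar hw) (h.Z_dot_normal hw) (h.Zbar_dot_normal hw)
    (h.normal_dot_normal hw) (h.Z_cross_Zbar hw) (h.normal_cross_Z hw) hbZ hdB hZZ hZB rfl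
    (hNN (-Complex.I)) (hNN Complex.I)
    (orth Complex.I dZ dN (fun u hu => h.Z_dot_normal hu))
  rw [← key, hopf, wirt_dotProduct (fun i => (dZ' i).fun_add (dG i)) dN]
  congr 2
  funext k
  rw [wirt_add (dZ' k) (dG k), second k, wirt_christoffel dZ dZ]
  simp only [Pi.add_apply, Pi.sub_apply, Pi.smul_apply, smul_eq_mul]
  ring

end IsConformalOn

/-! ### The modified Hopf differential and the vanishing of `dH`. -/

theorem two_mul_add_I_ne_zero (r : ℝ) : 2 * (r : ℂ) + Complex.I ≠ 0 := by
  intro h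
  have := congrArg Complex.im h
  simp at this

namespace IsConformalOn

variable {F G : ℂ → Nil} {U V : Set ℂ} {w : ℂ}

theorem contDiffAt_hopfCoeff (h : IsConformalOn F U) (hw : w ∈ U) :
    ContDiffAt ℝ ∞ (hopfCoeff F) w := by
  unfold hopfCoeff
  simp only [wirtinger_eq_wirt]
  have hZ := h.contDiffAt_Z hw
  have hN := fun k => ContDiffAt.ofReal (h.contDiffAt_normal hw k)
  have hdZ : ∀ k, ContDiffAt ℝ ∞ (wirt (-Complex.I) (Z F k)) w := fun k =>
    wirt_contDiffAt (hZ k) (by simp)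
  exact ContDiffAt.sum fun i _ => ((hdZ i).add (ContDiffAt.sum fun j _ => ContDiffAt.sum fun k _ =>
    ((hZ j).mul (hZ k)).mul contDiffAt_const)).mul (hN i)

theorem dbar_modifiedHopfCoeff (h : IsConformalOn F U) (hw : w ∈ U) :
    wirt Complex.I (modifiedHopfCoeff F) w
      = (firstForm F 1 1 w : ℂ) * wirt (-Complex.I) (fun u => (meanCurv F u : ℂ)) w / 2
        - 2 * wirt Complex.I (fun u => (meanCurv F u : ℂ)) w * Z F 2 w ^ 2
          / (2 * (meanCurv F w : ℂ) + Complex.I) ^ 2 := by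
  have dA := (h.contDiffAt_hopfCoeff hw).differentiableAt (by simp)
  have dZ := (h.contDiffAt_Z hw 2).differentiableAt (by simp)
  have dH : DifferentiableAt ℝ (fun u => (meanCurv F u : ℂ)) w :=
    (ContDiffAt.ofReal (h.contDiffAt_meanCurv hw)).differentiableAt (by simp)
  have hD := two_mul_add_I_ne_zero (meanCurv F w)
  have dD : DifferentiableAt ℝ (fun u => 2 * (meanCurv F u : ℂ) + Complex.I) w := by fun_prop
  have dQ : DifferentiableAt ℝ
      (fun u => Z F 2 u ^ 2 / (2 * (meanCurv F u : ℂ) + Complex.I)) w := by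
    simp only [div_eq_mul_inv]
    exact (dZ.pow 2).fun_mul (dD.fun_inv hD)
  -- The product rule for `(Z₃²/(2H + i)) · (2H + i) = Z₃²`, used as a quotient rule.
  have quot : wirt Complex.I (fun u => Z F 2 u ^ 2 / (2 * (meanCurv F u : ℂ) + Complex.I)) w
        * (2 * (meanCurv F w : ℂ) + Complex.I)
      + Z F 2 w ^ 2 / (2 * (meanCurv F w : ℂ) + Complex.I)
        * (2 * wirt Complex.I (fun u => (meanCurv F u : ℂ)) w)
      = 2 * Z F 2 w * wirt Complex.I (Z F 2) w := by
    have e1 : wirt Complex.I (fun u => 2 * (meanCurv F u : ℂ) + Complex.I) w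
        = 2 * wirt Complex.I (fun u => (meanCurv F u : ℂ)) w := by
      rw [wirt_add (dH.const_mul 2) (differentiableAt_const _), wirt_const_mul _ dH, wirt_const,
        add_zero]
    rw [← e1, ← wirt_mul dQ dD]
    have e2 : (fun u => Z F 2 u ^ 2 / (2 * (meanCurv F u : ℂ) + Complex.I)
        * (2 * (meanCurv F u : ℂ) + Complex.I)) = fun u => Z F 2 u * Z F 2 u := by
      funext u
      rw [div_mul_cancel₀ _ (two_mul_add_I_ne_zero _), sq]
    rw [e2, wirt_mul dZ dZ]
    ring
  -- This explains the denominator `2H + i`: `2H` comes from the normal term of `dbar_Z`, and `i`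
  -- from its Christoffel term, which is half of `(Z × Z̄)₃`.
  have third : wirt Complex.I (Z F 2) w
      = (firstForm F 1 1 w : ℂ) * (normal F w 2 : ℂ) * (2 * (meanCurv F w : ℂ) + Complex.I) / 4 := by
    have hc := congrFun (h.Z_cross_Zbar hw) 2
    simp [cross_apply] at hc
    rw [h.dbar_Z hw 2, christoffel_two]
    linear_combination (1 / 2) * hc
  have e : modifiedHopfCoeff F = fun u => hopfCoeff F u
      + Z F 2 u ^ 2 / (2 * (meanCurv F u : ℂ) + Complex.I) := rfl
  rw [e, wirt_add dA dQ, h.dbar_hopfCoeff hw]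
  rw [third] at quot
  generalize wirt Complex.I (fun u => Z F 2 u ^ 2 / (2 * (meanCurv F u : ℂ) + Complex.I)) w = q at *
  apply mul_right_cancel₀ hD
  field_simp at quot ⊢
  linear_combination (1 / 2) * quot

/-- Divided by `l`, the left side is the squared length of the tangential part of `e₃`; the defect
from one is `N₃²`. -/
theorem vel_two_sq_add_le (h : IsConformalOn F U) (hw : w ∈ U) :
    vel F 1 w 2 ^ 2 + vel F Complex.I w 2 ^ 2 ≤ firstForm F 1 1 w := by
  have hp : firstForm F 1 1 w = vel F 1 w ⬝ᵥ vel F 1 w := rfl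
  have he := h.eq w hw
  have ho := h.orthogonal w hw
  have pos := h.pos w hw
  have hq : firstForm F Complex.I Complex.I w = vel F Complex.I w ⬝ᵥ vel F Complex.I w := rfl
  rw [he] at hq
  rw [firstForm] at ho
  generalize firstForm F 1 1 w = l at *
  simp only [dotProduct, Fin.sum_univ_three] at hp hq ho
  generalize vel F 1 w = p at *
  generalize vel F Complex.I w = q at *
  have key : l * (l - (p 2 ^ 2 + q 2 ^ 2)) = (p 0 * q 1 - p 1 * q 0) ^ 2 := by
    linear_combination (l - q 2 ^ 2) * hp
      + (p 0 * p 0 + p 1 * p 1) * hq - (p 2 * q 2 - p 0 * q 0 - p 1 * q 1) * ho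
  have : 0 ≤ l - (p 2 ^ 2 + q 2 ^ 2) :=
    nonneg_of_mul_nonneg_right (by rw [key]; positivity) pos
  linarith

theorem fderiv_eq_zero_of_wirt {g : ℂ → ℝ} (hg : DifferentiableAt ℝ g w)
    (h : wirt (-Complex.I) (fun u => (g u : ℂ)) w = 0) : fderiv ℝ g w = 0 := by
  rw [wirt_ofReal hg] at h
  have hr := congrArg Complex.re h
  have hi := congrArg Complex.im h
  simp at hr hi
  ext v
  conv_lhs => rw [show v = v.re • (1 : ℂ) + v.im • Complex.I by simp [Complex.re_add_im]]
  rw [map_add, map_smul, map_smul, hr, hi]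
  simp

theorem meanCurv_eq_zero (h : IsConformalOn F U) (hw : w ∈ U)
    (hol : DifferentiableOn ℂ (modifiedHopfCoeff F) U)
    (hne : fderiv ℝ (meanCurv F) w ≠ 0) : meanCurv F w = 0 := by
  have dH := (h.contDiffAt_meanCurv hw).differentiableAt (by simp)
  have dH' : DifferentiableAt ℝ (fun u => (meanCurv F u : ℂ)) w :=
    (ContDiffAt.ofReal (h.contDiffAt_meanCurv hw)).differentiableAt (by simp)
  have hd := h.dbar_modifiedHopfCoeff hw
  rw [wirt_holomorphic (hol.differentiableAt (h.isOpen.mem_nhds hw))] at hd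
  have hD := two_mul_add_I_ne_zero (meanCurv F w)
  have hconj : wirt Complex.I (fun u => (meanCurv F u : ℂ)) w
      = (starRingEnd ℂ) (wirt (-Complex.I) (fun u => (meanCurv F u : ℂ)) w) := by
    have := wirt_conj (c := Complex.I) dH'
    simpa using this
  rw [hconj] at hd
  have hdne : wirt (-Complex.I) (fun u => (meanCurv F u : ℂ)) w ≠ 0 := fun h0 =>
    hne (fderiv_eq_zero_of_wirt dH h0)
  generalize wirt (-Complex.I) (fun u => (meanCurv F u : ℂ)) w = d at *
  have hd' : (firstForm F 1 1 w : ℂ) * (2 * (meanCurv F w : ℂ) + Complex.I) ^ 2 * d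
      = 4 * Z F 2 w ^ 2 * (starRingEnd ℂ) d := by
    field_simp at hd
    linear_combination -hd
  -- Moduli remove the unknown phase of `∂H`, leaving `l (4H² + 1) = 4|Z₃|²`.
  have hn := congrArg (fun z : ℂ => ‖z‖) hd'
  have pos := h.pos w hw
  simp only [norm_mul, norm_pow, RCLike.norm_conj, Complex.norm_real] at hn
  have hn' := mul_right_cancel₀ (norm_ne_zero_iff.mpr hdne) hn
  have n1 : ‖2 * (meanCurv F w : ℂ) + Complex.I‖ ^ 2 = 4 * meanCurv F w ^ 2 + 1 := by
    rw [← Complex.normSq_eq_norm_sq, Complex.normSq_apply]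
    simp
    ring
  have n2 : ‖Z F 2 w‖ ^ 2 = (vel F 1 w 2 ^ 2 + vel F Complex.I w 2 ^ 2) / 4 := by
    rw [← Complex.normSq_eq_norm_sq, Complex.normSq_apply]
    simp [Z]
    ring
  rw [n1, n2, Real.norm_of_nonneg pos.le] at hn'
  have hle := h.vel_two_sq_add_le hw
  have h4 : ‖(4 : ℂ)‖ = 4 := by simp
  rw [h4] at hn'
  have : firstForm F 1 1 w * meanCurv F w ^ 2 ≤ 0 := by nlinarith
  have : meanCurv F w ^ 2 ≤ 0 := nonpos_of_mul_nonpos_right this pos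
  nlinarith

theorem fderiv_meanCurv_eq_zero (h : IsConformalOn F U) (hw : w ∈ U)
    (hol : DifferentiableOn ℂ (modifiedHopfCoeff F) U) : fderiv ℝ (meanCurv F) w = 0 := by
  by_contra hne
  have hc : ContinuousAt (fderiv ℝ (meanCurv F)) w :=
    ((h.contDiffAt_meanCurv hw).fderiv_right (m := ∞) (by simp)).continuousAt
  have e : meanCurv F =ᶠ[nhds w] fun _ => 0 := by
    filter_upwards [h.isOpen.mem_nhds hw, hc.eventually_ne hne] with u hu hu'
      using h.meanCurv_eq_zero hu hol hu'
  exact hne (by rw [e.fderiv_eq]; simp)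

/-! ### Invariance of the mean curvature under change of parameter. -/

theorem vel_comp (h : IsConformalOn G V) {φ : ℂ → ℂ} (hφ : DifferentiableAt ℂ φ w)
    (hw : φ w ∈ V) (e : F =ᶠ[nhds w] fun u => G (φ u)) (v : ℂ) :
    vel F v w = (deriv φ w * v).re • vel G 1 (φ w)
      + (deriv φ w * v).im • vel G Complex.I (φ w) := by
  have hV := h.isOpen.mem_nhds hw
  have chain : ∀ g : Nil → ℝ, ContDiffOn ℝ ∞ (fun u => g (G u)) V →
      fderiv ℝ (fun u => g (F u)) w v
        = (deriv φ w * v).re * fderiv ℝ (fun u => g (G u)) (φ w) 1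
          + (deriv φ w * v).im * fderiv ℝ (fun u => g (G u)) (φ w) Complex.I := by
    intro g hg
    have dg : DifferentiableAt ℝ (fun u => g (G u)) (φ w) :=
      (hg.contDiffAt hV).differentiableAt (by simp)
    have e' : (fun u => g (F u)) =ᶠ[nhds w] (fun u => g (G u)) ∘ φ := by
      filter_upwards [e] with u hu
      simp [hu]
    rw [e'.fderiv_eq, (dg.hasFDerivAt.comp w (hφ.hasFDerivAt.restrictScalars ℝ)).fderiv]
    have hv : fderiv ℂ φ w v = deriv φ w * v := by
      rw [← fderiv_apply_one_eq_deriv, mul_comm, ← smul_eq_mul, ← map_smul, smul_eq_mul, mul_one]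
    simp only [ContinuousLinearMap.coe_comp, Function.comp_apply,
      ContinuousLinearMap.coe_restrictScalars', hv]
    have decomp : ∀ z : ℂ, z = z.re • (1 : ℂ) + z.im • Complex.I := fun z => by
      simp [Complex.re_add_im]
    conv_lhs => rw [decomp (deriv φ w * v)]
    rw [map_add, map_smul, map_smul, smul_eq_mul, smul_eq_mul]
  have hx := chain Nil.x h.smooth_x
  have hy := chain Nil.y h.smooth_y
  have hz := chain Nil.z h.smooth_z
  rw [vel_eq, vel_eq, vel_eq, hx, hy, hz, e.eq_of_nhds]
  funext i
  fin_cases i <;> simp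
  ring

/-- The second fundamental form is never transformed. Instead `Z` scales by the holomorphic factor
`φ'`, so `∂̄Z` scales by `|φ'|²`, as do `l` and the Christoffel term, while `N` is unchanged;
comparing the two instances of `dbar_Z` identifies the mean curvatures. -/
theorem meanCurv_comp (h : IsConformalOn F U) (h' : IsConformalOn G V) {φ : ℂ → ℂ}
    (hφ : DifferentiableOn ℂ φ U) (hm : Set.MapsTo φ U V) (e : ∀ u ∈ U, F u = G (φ u))
    (hw : w ∈ U) : meanCurv F w = meanCurv G (φ w) := by
  have hU := h.isOpen.mem_nhds hw
  have ev : ∀ u ∈ U, F =ᶠ[nhds u] fun u => G (φ u) := fun u hu => by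
    filter_upwards [h.isOpen.mem_nhds hu] with x hx using e x hx
  have dφ : ∀ u ∈ U, DifferentiableAt ℂ φ u := fun u hu =>
    hφ.differentiableAt (h.isOpen.mem_nhds hu)
  have dφ' : DifferentiableAt ℂ (deriv φ) w := (hφ.deriv h.isOpen).differentiableAt hU
  have hp : ∀ u ∈ U, vel F 1 u = (deriv φ u).re • vel G 1 (φ u)
      + (deriv φ u).im • vel G Complex.I (φ u) := fun u hu => by
    simpa using vel_comp h' (dφ u hu) (hm hu) (ev u hu) 1
  have hq : ∀ u ∈ U, vel F Complex.I u = (-(deriv φ u).im) • vel G 1 (φ u)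
      + (deriv φ u).re • vel G Complex.I (φ u) := fun u hu => by
    simpa using vel_comp h' (dφ u hu) (hm hu) (ev u hu) Complex.I
  have hZ : ∀ u ∈ U, ∀ k, Z F k u = Z G k (φ u) * deriv φ u := by
    intro u hu k
    rw [Z, Z, hp u hu, hq u hu]
    conv_rhs => rw [← Complex.re_add_im (deriv φ u)]
    simp only [Pi.add_apply, Pi.smul_apply, smul_eq_mul]
    push_cast
    linear_combination (vel G Complex.I (φ u) k * (deriv φ u).im / 2 : ℂ) * Complex.I_mul_I
  have hB : ∀ k, Zbar F k w = Zbar G k (φ w) * (starRingEnd ℂ) (deriv φ w) := fun k => by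
    rw [Zbar, Zbar, hZ w hw k, map_mul]
  have hL : firstForm F 1 1 w = ((deriv φ w).re ^ 2 + (deriv φ w).im ^ 2)
      * firstForm G 1 1 (φ w) := by
    have h1 := h'.eq _ (hm hw)
    have h2 := h'.orthogonal _ (hm hw)
    simp only [firstForm] at h1 h2 ⊢
    rw [hp w hw]
    simp only [dotProduct, Fin.sum_univ_three, Pi.add_apply, Pi.smul_apply, smul_eq_mul] at *
    linear_combination (deriv φ w).im ^ 2 * h1 + 2 * (deriv φ w).re * (deriv φ w).im * h2
  have hpos := h.pos w hw
  have hpos' := h'.pos _ (hm hw)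
  -- That `φ' ≠ 0` follows from both maps being immersions; injectivity of `φ` is not needed.
  have ha : 0 < (deriv φ w).re ^ 2 + (deriv φ w).im ^ 2 := by
    rw [hL] at hpos
    exact pos_of_mul_pos_left hpos hpos'.le
  have hN : normal F w = normal G (φ w) := by
    rw [h.normal_eq hw, h'.normal_eq (hm hw), hL, hp w hw, hq w hw]
    funext i
    fin_cases i <;> simp [cross_apply] <;> field_simp <;> ring
  have hconj : deriv φ w * (starRingEnd ℂ) (deriv φ w)
      = (((deriv φ w).re ^ 2 + (deriv φ w).im ^ 2 : ℝ) : ℂ) := by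
    rw [Complex.mul_conj, Complex.normSq_apply, sq, sq]
  have main : ∀ k, wirt Complex.I (Z F k) w
      = wirt Complex.I (Z G k) (φ w) * (deriv φ w * (starRingEnd ℂ) (deriv φ w)) := by
    intro k
    have dG : DifferentiableAt ℝ (Z G k) (φ w) :=
      (h'.contDiffAt_Z (hm hw) k).differentiableAt (by simp)
    have e1 : Z F k =ᶠ[nhds w] fun u => Z G k (φ u) * deriv φ u := by
      filter_upwards [hU] with u hu using hZ u hu k
    have dGφ : DifferentiableAt ℝ (fun u => Z G k (φ u)) w :=
      DifferentiableAt.comp w dG ((dφ w hw).restrictScalars ℝ)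
    rw [wirt_congr e1, wirt_mul dGφ (dφ'.restrictScalars ℝ), wirt_holomorphic dφ',
      wirt_comp_holomorphic (dφ w hw) dG]
    ring
  have hk : ∀ k, (((deriv φ w).re ^ 2 + (deriv φ w).im ^ 2 : ℝ) : ℂ)
      * (firstForm G 1 1 (φ w) : ℂ) * ((meanCurv F w : ℂ) - (meanCurv G (φ w) : ℂ))
      * (normal G (φ w) k : ℂ) = 0 := by
    intro k
    have m := main k
    have hG : christoffel (fun i => Zbar F i w) (fun i => Z F i w) k
        = christoffel (fun i => Zbar G i (φ w)) (fun i => Z G i (φ w)) k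
          * (deriv φ w * (starRingEnd ℂ) (deriv φ w)) := by
      simp only [hB, hZ w hw]
      fin_cases k <;> simp [christoffel] <;> ring
    rw [h.dbar_Z hw k, h'.dbar_Z (hm hw) k, hG, hN, hL, Complex.ofReal_mul, hconj] at m
    linear_combination 2 * m
  have hsum := h'.normal_dot_normal (hm hw)
  simp only [dotProduct, Fin.sum_univ_three] at hsum
  -- Pairing the vector identity `hk` with `N` removes the normal, as `⟨N, N⟩ = 1`.
  have hz : (((deriv φ w).re ^ 2 + (deriv φ w).im ^ 2 : ℝ) : ℂ)
      * (firstForm G 1 1 (φ w) : ℂ) * ((meanCurv F w : ℂ) - (meanCurv G (φ w) : ℂ)) = 0 := by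
    linear_combination (normal G (φ w) 0 : ℂ) * hk 0 + (normal G (φ w) 1 : ℂ) * hk 1
      + (normal G (φ w) 2 : ℂ) * hk 2 - (((deriv φ w).re ^ 2 + (deriv φ w).im ^ 2 : ℝ) : ℂ)
      * (firstForm G 1 1 (φ w) : ℂ) * ((meanCurv F w : ℂ) - (meanCurv G (φ w) : ℂ)) * hsum
  have hz' : ((deriv φ w).re ^ 2 + (deriv φ w).im ^ 2) * firstForm G 1 1 (φ w)
      * (meanCurv F w - meanCurv G (φ w)) = 0 := by exact_mod_cast hz
  have := (mul_eq_zero.mp hz').resolve_left (mul_pos ha hpos').ne'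
  linarith

end IsConformalOn

/-! ### From charts to the surface. -/

section Surface

variable {M : Type*} [TopologicalSpace M] [ChartedSpace ℂ M] [IsManifold 𝓘(ℂ, ℂ) ω M]

theorem contDiffOn_transition {e e' : OpenPartialHomeomorph M ℂ} (he : e ∈ atlas ℂ M)
    (he' : e' ∈ atlas ℂ M) : ContDiffOn ℂ ω (e.symm ≫ₕ e') (e.symm ≫ₕ e').source := by
  have h := HasGroupoid.compatible (G := contDiffGroupoid ω 𝓘(ℂ, ℂ)) he he'
  exact contMDiffOn_iff_contDiffOn.mp (contMDiffOn_of_mem_contDiffGroupoid h)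

theorem isManifold_real : IsManifold 𝓘(ℝ, ℂ) ∞ M := by
  apply isManifold_of_contDiffOn
  intro e e' he he'
  have h := ((contDiffOn_transition he he').restrict_scalars ℝ).of_le (m := ∞) (by simp)
  simpa using h

theorem IsConformalImmersion.isConformalOn {f : M → Nil} (hf : IsConformalImmersion f)
    {e : OpenPartialHomeomorph M ℂ} (he : e ∈ atlas ℂ M) :
    IsConformalOn (inChart f e) e.target := by
  have : IsManifold 𝓘(ℝ, ℂ) ∞ M := isManifold_real
  have hs : ContDiffOn ℝ ∞ (fun w => (inChart f e w).coords) e.target := by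
    rw [← contMDiffOn_iff_contDiffOn]
    exact hf.smooth.comp_contMDiffOn
      (contMDiffOn_symm_of_mem_maximalAtlas (IsManifold.subset_maximalAtlas he))
  rw [contDiffOn_pi] at hs
  exact ⟨e.open_target, hs 0, hs 1, hs 2, hf.pos e he, hf.eq e he, hf.orthogonal e he⟩

theorem IsConformalImmersion.meanCurv_transition {f : M → Nil} (hf : IsConformalImmersion f)
    {e e' : OpenPartialHomeomorph M ℂ} (he : e ∈ atlas ℂ M) (he' : e' ∈ atlas ℂ M) {p : M}
    (hp : p ∈ e.source) (hp' : p ∈ e'.source) :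
    meanCurv (inChart f e) (e p) = meanCurv (inChart f e') (e' p) := by
  have h := hf.isConformalOn he
  have h' := hf.isConformalOn he'
  have hsub : (e.symm ≫ₕ e').source ⊆ e.target := by
    intro u hu
    simp at hu
    exact hu.1
  have hU : IsConformalOn (inChart f e) (e.symm ≫ₕ e').source :=
    ⟨(e.symm ≫ₕ e').open_source, h.smooth_x.mono hsub, h.smooth_y.mono hsub,
      h.smooth_z.mono hsub, fun w hw => h.pos w (hsub hw), fun w hw => h.eq w (hsub hw),
      fun w hw => h.orthogonal w (hsub hw)⟩
  have key := hU.meanCurv_comp (w := e p) h'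
    ((contDiffOn_transition he he').differentiableOn (by simp))
    (fun u hu => by
      simp at hu ⊢
      exact e'.map_source hu.2)
    (fun u hu => by
      simp at hu
      simp [inChart, e'.left_inv hu.2])
    (by simp [hp, hp'])
  rw [key]
  simp [hp]

/-- `meanCurvature` uses a different preferred chart at each point, so values near `p` are first
moved to the chart at `p`, where `dH = 0` on a ball. -/
theorem isLocallyConstant_meanCurvature {f : M → Nil} (hf : IsConformalImmersion f)
    (hol : ModifiedHopfHolomorphic f) : IsLocallyConstant (meanCurvature f) := by
  rw [IsLocallyConstant.iff_eventually_eq]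
  intro p
  have he := chart_mem_atlas ℂ p
  have h := hf.isConformalOn he
  obtain ⟨r, hr, hball⟩ := Metric.isOpen_iff.mp h.isOpen _ (mem_chart_target ℂ p)
  have hc : ∀ u ∈ Metric.ball (chartAt ℂ p p) r, meanCurv (inChart f (chartAt ℂ p)) u
      = meanCurv (inChart f (chartAt ℂ p)) (chartAt ℂ p p) := fun u hu =>
    Metric.isOpen_ball.is_const_of_fderiv_eq_zero (𝕜 := ℝ)
      (convex_ball _ _).isPreconnected
      (fun v hv => ((h.contDiffAt_meanCurv (hball hv)).differentiableAt
        (by simp)).differentiableWithinAt)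
      (fun v hv => h.fderiv_meanCurv_eq_zero (hball hv) (hol _ he)) hu (Metric.mem_ball_self hr)
  have hcont : ContinuousAt (chartAt ℂ p) p :=
    (chartAt ℂ p).continuousAt (mem_chart_source ℂ p)
  filter_upwards [(chartAt ℂ p).open_source.mem_nhds (mem_chart_source ℂ p),
    hcont.preimage_mem_nhds (Metric.ball_mem_nhds _ hr)] with q hq hq'
  rw [meanCurvature, hf.meanCurv_transition (chart_mem_atlas ℂ q) he (mem_chart_source ℂ q) hq,
    hc _ hq', meanCurvature]

end Surface

end

end NilGeometry

theorem mainTheorem6 {M : Type*} [TopologicalSpace M] [ConnectedSpace M] [ChartedSpace ℂ M]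
    [IsManifold 𝓘(ℂ, ℂ) ω M] (f : M → NilGeometry.Nil)
    (hf : NilGeometry.IsConformalImmersion f)
    (hol : NilGeometry.ModifiedHopfHolomorphic f) :
    ∃ c : ℝ, ∀ p : M, NilGeometry.meanCurvature f p = c := by
  obtain ⟨c, hc⟩ := (NilGeometry.isLocallyConstant_meanCurvature hf hol).exists_eq_const
  exact ⟨c, fun p => congrFun hc p⟩
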